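/- Let $p$ be a prime, let $G$ be a finite non-abelian $p$-group and let $n\ge 2$ be an integer. Write $Z(G)$ for the center of $G$, $\gamma_1(G)=G$, $\gamma_{k+1}(G)=[\gamma_k(G),G]$ for the lower central series, $d(A)$ for the rank (minimal number of generators) of a finite abelian group $A$, and $\exp$ for the exponent of a group. Let $\mathrm{Autcent}(G)$ be the group of automorphisms $\alpha$ of $G$ with $g^{-1}\alpha(g)\in Z(G)$ for all $g\in G$, and, for normal subgroups $M,N$ of $G$, let $\mathrm{Aut}_N^M(G)$ be the group of automorphisms of $G$ which fix $M$ setwise, act trivially on $G/M$, and fix $N$ element-wise. For finite abelian $p$-groups $H\le K$ with $d(H)=d(K)$, define $\mathrm{var}(H,K)=1$ if $H=K$; if $H<K$, write $H\cong C_{p^{n_1}}\times\cdots\times C_{p^{n_s}}$ and $K\cong C_{p^{m_1}}\times\cdots\times C_{p^{m_s}}$ with $n_1\ge\cdots\ge n_s\geq 1$, $m_1\ge\cdots\ge m_s\ge 1$, and put $\mathrm{var}(H,K)=p^{n_r}$, where $r$ is the unique index with $n_r<m_r$ and $n_j=m_j$ for all $j>r$. Suppose that $\mathrm{Aut}_{Z(G)}^{\gamma_n(G)}(G)=\mathrm{Autcent}(G)$.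 Then 1. $\gamma_n(G)\le Z(G)$ and $d(\gamma_n(G))=d(Z(G))$; 2. if $\exp(G/\gamma_2(G))>\mathrm{var}(\gamma_n(G),Z(G))$, then $\gamma_n(G)=Z(G)$. Conversely, if $\gamma_n(G)=Z(G)$, then $\exp(G/\gamma_2(G))>\mathrm{var}(\gamma_n(G),Z(G))$ and $\mathrm{Aut}_{Z(G)}^{\gamma_n(G)}(G)=\mathrm{Autcent}(G)$. -/

import Mathlib

namespace CentralAut

/-- The `n`-th term `γ_n(G)` of the lower central series, with the convention `γ_1(G) = G`,
`γ_{k+1}(G) = [γ_k(G), G]` (Mathlib's series starts at index `0`). Only used for `n ≥ 1`. -/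
def gamma (G : Type*) [Group G] (n : ℕ) : Subgroup G :=
  (⊤ : Subgroup G).lowerCentralSeries (n - 1)

instance gamma_normal (G : Type*) [Group G] (n : ℕ) : (gamma G n).Normal := by
  unfold gamma
  infer_instance

/-- `Autcent(G)`: the automorphisms `α` with `g⁻¹ α(g) ∈ Z(G)` for all `g`. -/
def autcent (G : Type*) [Group G] : Subgroup (MulAut G) where
  carrier := {α | ∀ g : G, g⁻¹ * α g ∈ Subgroup.center G}
  one_mem' := by
    intro g
    simp
  mul_mem' := by
    intro α β hα hβ g
    have h := mul_mem (hβ g) (hα (β g))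
    simpa [mul_assoc] using h
  inv_mem' := by
    intro α hα g
    have h := inv_mem (hα (α⁻¹ g))
    simpa using h

/-- `Aut^M(G)`: the automorphisms of `G` which fix `M` setwise and act trivially on `G/M`,
i.e. `α(g) M = g M` for all `g`. -/
def autUpper {G : Type*} [Group G] (M : Subgroup G) : Subgroup (MulAut G) where
  carrier := {α | M.map α.toMonoidHom = M ∧ ∀ g : G, g⁻¹ * α g ∈ M}
  one_mem' := by
    refine ⟨?_, fun g => by simp⟩
    ext x
    simp
  mul_mem' := by
    rintro α β ⟨hα, hα'⟩ ⟨hβ, hβ'⟩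
    refine ⟨?_, fun g => ?_⟩
    · have h : (α * β).toMonoidHom = α.toMonoidHom.comp β.toMonoidHom := rfl
      rw [h, ← Subgroup.map_map, hβ, hα]
    · have h := mul_mem (hβ' g) (hα' (β g))
      simpa [mul_assoc] using h
  inv_mem' := by
    rintro α ⟨hα, hα'⟩
    refine ⟨?_, fun g => ?_⟩
    · have h : (α⁻¹).toMonoidHom.comp α.toMonoidHom = MonoidHom.id G := by
        ext x
        exact α.symm_apply_apply x
      conv_lhs => rw [← hα]
      rw [Subgroup.map_map, h, Subgroup.map_id]
    · have h := inv_mem (hα' (α⁻¹ g))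
      simpa using h

/-- `Aut_N(G)`: the automorphisms of `G` which fix `N` element-wise. -/
def autLower {G : Type*} [Group G] (N : Subgroup G) : Subgroup (MulAut G) :=
  fixingSubgroup (MulAut G) (N : Set G)

/-- `Aut_N^M(G) = Aut^M(G) ∩ Aut_N(G)`. -/
def autUpperLower {G : Type*} [Group G] (M N : Subgroup G) : Subgroup (MulAut G) :=
  autUpper M ⊓ autLower N

/-- `A ≅ C_{p^{n_1}} × ⋯ × C_{p^{n_s}}` with `n_1 ≥ ⋯ ≥ n_s` positive: the cyclic
decomposition of a finite abelian `p`-group. -/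
def IsCyclicDecomposition (p : ℕ) (A : Type*) [Group A] {s : ℕ} (e : Fin s → ℕ) : Prop :=
  Antitone e ∧ (∀ i, 0 < e i) ∧
    Nonempty (A ≃* ((i : Fin s) → Multiplicative (ZMod (p ^ e i))))

/-- `v` is the order of the last cyclic factor of `H` whose order is less than that of the
corresponding cyclic factor of `K`, where `H` is a proper subgroup of `K` and both have the
same number of cyclic factors. -/
def IsLastSmallerFactor (p : ℕ) {G : Type*} [Group G] (H K : Subgroup G) (v : ℕ) : Prop :=
  H < K ∧ ∃ (s : ℕ) (e f : Fin s → ℕ) (r : Fin s),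
    IsCyclicDecomposition p H e ∧ IsCyclicDecomposition p K f ∧
      e r < f r ∧ (∀ j, r < j → e j = f j) ∧ v = p ^ e r

open Classical in
/-- `var(H, K)` for finite abelian `p`-subgroups `H ≤ K` of `G` of equal rank: it is `1` if
`H = K`, and otherwise the order of the last cyclic factor of `H` which is smaller than the
corresponding factor of `K`. In the latter case there is exactly one such order `v`, by
uniqueness of the cyclic decomposition, so that `sInf` merely picks the element of a
one-element set. -/
noncomputable def var (p : ℕ) {G : Type*} [Group G] (H K : Subgroup G) : ℕ :=
  if H = K then 1 else sInf {v | IsLastSmallerFactor p H K v}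

end CentralAut

namespace CentralAut

open scoped commutatorElement

/-! Conjugations by elements of `γ_{n-1}(G)` lie in `Aut_Z^{γ_n}`; if they are central, then `γ_n ≤
Z`. A homomorphism `f : G → Z` gives the central automorphism `g ↦ g f(g)` unless `f z = z⁻¹` for
some `z ≠ 1`; if central automorphisms are trivial modulo `γ_n`, then `f` takes values in `γ_n`.
Maps onto `⟨z⟩` that kill `z`, for `z ∈ Z` of order `p`, put the `p`-torsion of `Z` into `γ_n`, so
the ranks agree (`mem_of_pow_prime_eq_one`). This torsion then lies in `[G, G]`, so no `f` is
exceptional, and `γ_n` contains every `z ∈ Z` of order dividing `exp(G/[G, G])`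
(`mem_of_orderOf_dvd_exponent`). If `γ_n < Z` and `var = p^m`, counting solutions of `x^(p^(m+1)) =
1` gives one in `Z` outside `γ_n`, so `exp(G/[G, G]) ≤ p^m`. Conversely, `g ↦ g⁻¹ α(g)` kills `[G,
G]`, hence `Z` when `Z = γ_n`. -/

/-! ### Finite abelian `p`-groups and their invariants -/

theorem exists_isCyclicDecomposition (p : ℕ) [hp : Fact p.Prime] (A : Type*) [CommGroup A]
    [Finite A] (hA : IsPGroup p A) : ∃ (s : ℕ) (e : Fin s → ℕ), IsCyclicDecomposition p A e := by
  obtain ⟨ι, _, n, hn, ⟨φ⟩⟩ := CommGroup.equiv_prod_multiplicative_zmod_of_finite A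
  classical
  have hpow : ∀ i, ∃ k, n i = p ^ k := by
    intro i
    obtain ⟨k, hk⟩ := hA (φ.symm (Pi.mulSingle i (Multiplicative.ofAdd 1)))
    rw [← map_pow, MulEquiv.map_eq_one_iff, ← Pi.mulSingle_pow, Pi.mulSingle_eq_one_iff,
      ← ofAdd_nsmul, ofAdd_eq_one, nsmul_one, ZMod.natCast_eq_zero_iff] at hk
    obtain ⟨m, -, hm⟩ := (Nat.dvd_prime_pow hp.out).1 hk
    exact ⟨m, hm⟩
  choose k hk using hpow
  let σ : Fin (Fintype.card ι) ≃ ι := (Fintype.equivFin ι).symm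
  let g : Fin (Fintype.card ι) → ℕᵒᵈ := fun i => OrderDual.toDual (k (σ i))
  let τ : Fin (Fintype.card ι) ≃ ι := (Tuple.sort g).trans σ
  refine ⟨_, fun i => k (τ i), ?_, fun i => ?_, ⟨φ.trans ?_⟩⟩
  · intro i j hij
    exact Tuple.monotone_sort g hij
  · rw [Nat.pos_iff_ne_zero]
    intro h0
    dsimp only at h0
    have := hn (τ i)
    rw [hk, h0, pow_zero] at this
    exact lt_irrefl _ this
  · obtain rfl : n = fun i => p ^ k i := funext hk
    exact { toFun := fun x i => x (τ i)
            invFun := fun y => Equiv.piCongrLeft (fun i => Multiplicative (ZMod (p ^ k i))) τ y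
            left_inv := fun x => by
              ext j
              obtain ⟨i, rfl⟩ := τ.surjective j
              simp
            right_inv := fun y => by
              ext i
              simp
            map_mul' := fun x y => rfl }

/-- These counts compare the exponents of two groups without appeal to uniqueness of decompositions.
-/
theorem IsCyclicDecomposition.card_pow_eq_one {p : ℕ} [hp : Fact p.Prime] {A : Type*} [Group A]
    {s : ℕ} {e : Fin s → ℕ} (h : IsCyclicDecomposition p A e) (k : ℕ) :
    Nat.card {a : A // a ^ p ^ k = 1} = ∏ i, p ^ min (e i) k := by
  obtain ⟨-, -, ⟨φ⟩⟩ := h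
  have e1 : {a : A // a ^ p ^ k = 1} ≃
      ((i : Fin s) → (powMonoidHom (p ^ k) : Multiplicative (ZMod (p ^ e i)) →* _).ker) :=
    (φ.toEquiv.subtypeEquiv (q := fun x => ∀ i, x i ∈
      (powMonoidHom (p ^ k) : Multiplicative (ZMod (p ^ e i)) →* _).ker) (fun a => by
        rw [← MulEquiv.map_eq_one_iff φ, map_pow, funext_iff]
        rfl)).trans Equiv.subtypePiEquivPi
  rw [Nat.card_congr e1, Nat.card_pi]
  refine Finset.prod_congr rfl fun i _ => ?_
  have : NeZero (p ^ e i) := ⟨pow_ne_zero _ hp.out.ne_zero⟩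
  have : Finite (Multiplicative (ZMod (p ^ e i))) := inferInstanceAs (Finite (ZMod (p ^ e i)))
  rw [IsCyclic.card_powMonoidHom_ker]
  have : Nat.card (Multiplicative (ZMod (p ^ e i))) = p ^ e i := Nat.card_zmod _
  rw [this]
  rcases le_total (e i) k with hik | hik
  · rw [min_eq_left hik, Nat.gcd_eq_left (pow_dvd_pow _ hik)]
  · rw [min_eq_right hik, Nat.gcd_eq_right (pow_dvd_pow _ hik)]

theorem IsCyclicDecomposition.card_pow_prime_eq_one {p : ℕ} [Fact p.Prime] {A : Type*} [Group A]
    {s : ℕ} {e : Fin s → ℕ} (h : IsCyclicDecomposition p A e) :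
    Nat.card {a : A // a ^ p = 1} = p ^ s := by
  have h1 := h.card_pow_eq_one 1
  rw [pow_one] at h1
  rw [h1, Finset.prod_congr rfl fun i _ => by rw [min_eq_right (h.2.1 i), pow_one]]
  simp

theorem IsCyclicDecomposition.rank_eq {p : ℕ} [hp : Fact p.Prime] {A : Type*} [Group A]
    [IsMulCommutative A] [Finite A] {s : ℕ} {e : Fin s → ℕ} (h : IsCyclicDecomposition p A e) :
    Group.rank A = s := by
  apply le_antisymm
  · obtain ⟨-, -, ⟨φ⟩⟩ := h
    have : Finite ((i : Fin s) → Multiplicative (ZMod (p ^ e i))) := Finite.of_equiv A φ.toEquiv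
    rw [Group.rank_congr φ]
    classical
    let S : Finset ((i : Fin s) → Multiplicative (ZMod (p ^ e i))) :=
      Finset.univ.image fun i => Pi.mulSingle i (Multiplicative.ofAdd 1)
    have hS : Subgroup.closure (S : Set ((i : Fin s) → Multiplicative (ZMod (p ^ e i)))) = ⊤ := by
      rw [eq_top_iff]
      intro x _
      rw [← Finset.univ_prod_mulSingle x]
      refine Subgroup.prod_mem _ fun i _ => ?_
      have : NeZero (p ^ e i) := ⟨pow_ne_zero _ hp.out.ne_zero⟩
      have hx : x i = (Multiplicative.ofAdd 1) ^ (Multiplicative.toAdd (x i)).val := by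
        rw [← ofAdd_nsmul, nsmul_one, ZMod.natCast_zmod_val, ofAdd_toAdd]
      rw [hx, Pi.mulSingle_pow]
      exact Subgroup.pow_mem _ (Subgroup.subset_closure (by simp [S])) _
    exact (Group.rank_le hS).trans (Finset.card_image_le.trans (by simp))
  -- `A/A^p` has as many elements as the `p`-torsion of `A`, and it has exponent dividing `p`, so it
  -- needs at least `s` generators.
  · let _ : CommGroup A := { (inferInstance : Group A) with mul_comm := mul_comm' }
    let R : Subgroup A := (powMonoidHom p : A →* A).range
    have h1 : Nat.card (A ⧸ R) = p ^ s := by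
      have : R.index = Nat.card (powMonoidHom p : A →* A).ker := Subgroup.index_range
      rw [← h.card_pow_prime_eq_one]
      exact this
    have h2 : p ^ s ∣ p ^ Group.rank (A ⧸ R) := by
      rw [← h1]
      refine card_dvd_exponent_pow_rank' (A ⧸ R) fun g => ?_
      induction g using QuotientGroup.induction_on with
      | H a => exact (QuotientGroup.eq_one_iff (a ^ p)).2 ⟨a, rfl⟩
    exact ((Nat.pow_dvd_pow_iff_le_right hp.out.one_lt).1 h2).trans
      (Group.rank_le_of_surjective (QuotientGroup.mk' R) (QuotientGroup.mk'_surjective R))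

/-- If `r` is the last index where `e` and `f` differ, and `e r < f r`, then a group with exponents
`e` has fewer solutions of `a ^ p ^ (e r + 1) = 1` than one with exponents `f`. -/
theorem prod_pow_min_lt {p : ℕ} (hp : 1 < p) {s : ℕ} {e f : Fin s → ℕ} {r : Fin s}
    (hf : Antitone f) (hr : e r < f r) (h : ∀ j, r < j → e j = f j) :
    ∏ i, p ^ min (e i) (e r + 1) < ∏ i, p ^ min (f i) (e r + 1) := by
  refine Finset.prod_lt_prod (fun i _ => by positivity) (fun i _ => ?_)
    ⟨r, Finset.mem_univ _, Nat.pow_lt_pow_right hp ?_⟩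
  · refine Nat.pow_le_pow_right hp.le ?_
    rcases lt_or_ge r i with hi | hi
    · rw [h i hi]
    -- For `i ≤ r`, `f i ≥ f r ≥ e r + 1`, so the right-hand minimum is `e r + 1`.
    · have := hf hi
      omega
  · omega

/-- Some cyclic factor of `A` has order at least `p ^ k`, by the exponent; project to it and send
its generator to `b`. -/
theorem exists_monoidHom_range_eq_zpowers {p : ℕ} [hp : Fact p.Prime] {A B : Type*} [CommGroup A]
    [Finite A] (hA : IsPGroup p A) [Group B] {b : B} {k : ℕ} (hb : orderOf b = p ^ k)
    (hk : p ^ k ∣ Monoid.exponent A) : ∃ f : A →* B, f.range = Subgroup.zpowers b := by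
  obtain ⟨s, e, -, -, ⟨φ⟩⟩ := exists_isCyclicDecomposition p A hA
  -- A trivial `A` has no cyclic factor to project to, so `k = 0` is separate.
  rcases Nat.eq_zero_or_pos k with rfl | hk0
  · refine ⟨1, ?_⟩
    rw [pow_zero, orderOf_eq_one_iff] at hb
    simp [hb, Subgroup.zpowers_one_eq_bot]
  have hi : ∃ i, k ≤ e i := by
    by_contra! hlt
    have h1 : Monoid.exponent A ∣ p ^ (k - 1) := by
      refine Monoid.exponent_dvd_of_forall_pow_eq_one fun a => φ.injective ?_
      rw [map_pow, map_one]
      funext i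
      have hd : p ^ e i ∣ p ^ (k - 1) := pow_dvd_pow _ (by have := hlt i; omega)
      rw [Pi.pow_apply, Pi.one_apply, ← toAdd_eq_zero, toAdd_pow]
      obtain ⟨c, hc⟩ := hd
      rw [hc, nsmul_eq_mul]
      simp
    have := (Nat.pow_dvd_pow_iff_le_right hp.out.one_lt).1 (hk.trans h1)
    omega
  obtain ⟨i, hi⟩ := hi
  have hb' : zmultiplesHom (Additive B) (Additive.ofMul b) ((p ^ e i : ℕ) : ℤ) = 0 := by
    rw [zmultiplesHom_apply, natCast_zsmul, ← ofMul_pow, ofMul_eq_zero]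
    exact orderOf_dvd_iff_pow_eq_one.1 (hb ▸ pow_dvd_pow _ hi)
  let g : ZMod (p ^ e i) →+ Additive B := ZMod.lift _ ⟨_, hb'⟩
  have hg : ∀ m : ℤ, g (m : ZMod (p ^ e i)) = m • Additive.ofMul b := fun m => by
    simp [g, ZMod.lift_coe]
  let F : A →* B := (AddMonoidHom.toMultiplicativeLeft g).comp
    ((Pi.evalMonoidHom _ i).comp φ.toMonoidHom)
  refine ⟨F, le_antisymm ?_ ?_⟩
  · rintro _ ⟨a, rfl⟩
    obtain ⟨m, hm⟩ := ZMod.intCast_surjective (Multiplicative.toAdd (φ a i))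
    refine ⟨m, ?_⟩
    have : F a = (g (Multiplicative.toAdd (φ a i))).toMul := rfl
    rw [this, ← hm, hg]
    rfl
  · rw [Subgroup.zpowers_le]
    classical
    refine ⟨φ.symm (Pi.mulSingle i (Multiplicative.ofAdd ((1 : ℤ) : ZMod (p ^ e i)))), ?_⟩
    have : ∀ a, F a = (g (Multiplicative.toAdd (φ a i))).toMul := fun _ => rfl
    rw [this, MulEquiv.apply_symm_apply, Pi.mulSingle_eq_same, toAdd_ofAdd, hg, one_zsmul]
    rfl

/-! ### Homomorphisms to the center and central automorphisms -/

variable {G : Type*} [Group G]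

/-- An element with `g * f g = 1` is itself central, so injectivity need only be tested on the
center. -/
theorem exists_mem_autcent_apply [Finite G] (f : G →* Subgroup.center G)
    (hf : ∀ z : Subgroup.center G, f z = z⁻¹ → z = 1) :
    ∃ α ∈ autcent G, ∀ g, α g = g * f g := by
  let F : G →* G :=
    { toFun := fun g => g * f g
      map_one' := by simp
      map_mul' := fun a b => by
        have := Subgroup.mem_center_iff.1 (f a).2 b
        rw [map_mul, Subgroup.coe_mul, mul_assoc, mul_assoc, ← mul_assoc b, this, mul_assoc] }
  have hinj : Function.Injective F := by
    rw [injective_iff_map_eq_one]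
    intro g hg
    have h1 : g = ((f g)⁻¹ : Subgroup.center G) := by
      rw [Subgroup.coe_inv]
      exact eq_inv_of_mul_eq_one_left hg
    have h2 := hf (f g)⁻¹ (by rw [← h1, inv_inv])
    rw [h1, h2, Subgroup.coe_one]
  let α : MulAut G := MulEquiv.ofBijective F (Finite.injective_iff_bijective.1 hinj)
  have hα : ∀ g, α g = g * f g := fun _ => rfl
  refine ⟨α, fun g => ?_, hα⟩
  rw [hα, inv_mul_cancel_left]
  exact (f g).2

theorem map_eq_one_of_mem_commutator (f : G →* Subgroup.center G) {g : G}
    (hg : g ∈ commutator G) : f g = 1 := by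
  let _ : CommGroup (Subgroup.center G) := { (inferInstance : Group (Subgroup.center G)) with
    mul_comm := fun a b => Subtype.ext (Subgroup.mem_center_iff.1 b.2 a) }
  exact Abelianization.commutator_subset_ker f hg

theorem gamma_two (G : Type*) [Group G] : gamma G 2 = commutator G :=
  Subgroup.top_lowerCentralSeries_one

theorem gamma_le_commutator {n : ℕ} (hn : 2 ≤ n) : gamma G n ≤ commutator G := by
  rw [← gamma_two]
  exact (⊤ : Subgroup G).lowerCentralSeries_antitone (by omega)

theorem exponent_quotient_gamma_two (G : Type*) [Group G] :
    Monoid.exponent (G ⧸ gamma G 2) = Monoid.exponent (Abelianization G) :=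
  Monoid.exponent_eq_of_mulEquiv (QuotientGroup.quotientMulEquivOfEq (gamma_two G))

theorem autUpperLower_center_eq_autcent {M : Subgroup G} (hM : M = Subgroup.center G)
    (h : M ≤ commutator G) : autUpperLower M (Subgroup.center G) = autcent G := by
  subst hM
  ext α
  refine ⟨fun hα => hα.1.2, fun hα => ?_⟩
  let f : G →* Subgroup.center G :=
    { toFun := fun g => ⟨g⁻¹ * α g, hα g⟩
      map_one' := by simp
      map_mul' := fun a b => by
        ext
        have := Subgroup.mem_center_iff.1 (hα a) b⁻¹
        simp only [map_mul, mul_inv_rev, Subgroup.coe_mul]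
        rw [← mul_assoc, mul_assoc b⁻¹, this, mul_assoc] }
  have hfix : ∀ z ∈ Subgroup.center G, α z = z := by
    intro z hz
    have h1 : f z = 1 := map_eq_one_of_mem_commutator f (h hz)
    have h2 : z⁻¹ * α z = 1 := congrArg Subtype.val h1
    rw [inv_mul_eq_one] at h2
    exact h2.symm
  refine ⟨⟨?_, hα⟩, ?_⟩
  · ext x
    constructor
    · rintro ⟨z, hz, rfl⟩
      have : α.toMonoidHom z = z := hfix z hz
      rwa [this]
    · exact fun hx => ⟨x, hx, hfix x hx⟩
  · exact fun z => hfix z z.2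

theorem gamma_le_center_of_le_autcent {n : ℕ} (hn : 2 ≤ n)
    (h : autUpperLower (gamma G n) (Subgroup.center G) ≤ autcent G) :
    gamma G n ≤ Subgroup.center G := by
  obtain ⟨m, rfl⟩ : ∃ m, n = m + 2 := ⟨n - 2, by omega⟩
  have hγ : gamma G (m + 2) = ⁅(⊤ : Subgroup G).lowerCentralSeries m, ⊤⁆ := rfl
  conv_lhs => rw [hγ]
  rw [Subgroup.commutator_le]
  intro x hx g _
  -- Here `x ∈ γ_{m+1}(G)`, so conjugation by `x` moves each element by a commutator in
  -- `γ_{m+2}(G)`.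
  have hconj : MulAut.conj x ∈ autUpperLower (gamma G (m + 2)) (Subgroup.center G) := by
    refine ⟨⟨?_, fun g => ?_⟩, fun z => ?_⟩
    · exact Subgroup.Normal.map_conj_eq _ x
    · have hmem : ⁅g⁻¹, x⁆ ∈ gamma G (m + 2) := by
        rw [hγ, Subgroup.commutator_comm]
        exact Subgroup.commutator_mem_commutator (Subgroup.mem_top _) hx
      rw [commutatorElement_def, inv_inv] at hmem
      simpa [mul_assoc] using hmem
    · have := Subgroup.mem_center_iff.1 z.2 x
      change x * z * x⁻¹ = z
      rw [this, mul_inv_cancel_right]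
  have h1 : ⁅g, x⁆ ∈ Subgroup.center G := by
    simpa [commutatorElement_def, mul_assoc] using h hconj g⁻¹
  rw [← commutatorElement_inv]
  exact inv_mem h1

/-- The map onto `⟨z⟩` is taken through the abelianization of `G/⟨z⟩`, which is nontrivial because
`G` is not abelian; thus it kills `z`. -/
theorem mem_of_pow_prime_eq_one {p : ℕ} [hp : Fact p.Prime] [Finite G] (hG : IsPGroup p G)
    (hna : ∃ a b : G, a * b ≠ b * a) {M : Subgroup G} (hM : autcent G ≤ autUpper M) {z : G}
    (hz : z ∈ Subgroup.center G) (hzp : z ^ p = 1) : z ∈ M := by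
  rcases eq_or_ne z 1 with rfl | hz1
  · exact one_mem M
  let H : Subgroup G := Subgroup.zpowers z
  have hHZ : H ≤ Subgroup.center G := by rwa [Subgroup.zpowers_le]
  have hH : H.Normal := ⟨fun x hx g => by
    rwa [Subgroup.mem_center_iff.1 (hHZ hx) g, mul_inv_cancel_right]⟩
  have hHtop : H ≠ ⊤ := by
    intro h
    obtain ⟨a, b, hab⟩ := hna
    have hb : b ∈ Subgroup.center G := hHZ (h ▸ Subgroup.mem_top b)
    exact hab (Subgroup.mem_center_iff.1 hb a)
  have : Nontrivial (G ⧸ H) := QuotientGroup.nontrivial_iff.2 hHtop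
  have hQ : IsPGroup p (G ⧸ H) := hG.to_quotient H
  have : Group.IsNilpotent (G ⧸ H) := hQ.isNilpotent
  have hA : IsPGroup p (Abelianization (G ⧸ H)) := hQ.to_quotient _
  have : Nontrivial (Abelianization (G ⧸ H)) :=
    QuotientGroup.nontrivial_iff.2 (Group.IsSolvable.commutator_lt_top_of_nontrivial _).ne
  have hexp : p ^ 1 ∣ Monoid.exponent (Abelianization (G ⧸ H)) := by
    obtain ⟨x, hx⟩ := exists_ne (1 : Abelianization (G ⧸ H))
    obtain ⟨k, hk⟩ := IsPGroup.iff_orderOf.1 hA x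
    have hk0 : k ≠ 0 := by
      rintro rfl
      exact hx (orderOf_eq_one_iff.1 (by rw [hk, pow_zero]))
    exact ((pow_dvd_pow p (Nat.one_le_iff_ne_zero.2 hk0)).trans hk.symm.dvd).trans
      (Monoid.order_dvd_exponent x)
  have hord : orderOf (⟨z, hz⟩ : Subgroup.center G) = p ^ 1 := by
    rw [pow_one, Subgroup.orderOf_mk]
    exact orderOf_eq_prime hzp hz1
  obtain ⟨f, hf⟩ := exists_monoidHom_range_eq_zpowers hA hord hexp
  let F : G →* Subgroup.center G := f.comp (Abelianization.of.comp (QuotientGroup.mk' H))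
  have hF : ∀ x ∈ H, F x = 1 := by
    intro x hx
    have : QuotientGroup.mk' H x = 1 := (QuotientGroup.eq_one_iff x).2 hx
    simp only [F, MonoidHom.comp_apply, this, map_one]
  have hFmem : ∀ x, F x ∈ Subgroup.zpowers (⟨z, hz⟩ : Subgroup.center G) := by
    intro x
    rw [← hf]
    exact ⟨_, rfl⟩
  obtain ⟨α, hα, hαF⟩ := exists_mem_autcent_apply F (by
    intro w hw
    have h1 := hFmem w
    rw [hw, inv_mem_iff] at h1
    have h2 : (w : G) ∈ H := by
      obtain ⟨m, rfl⟩ := h1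
      exact ⟨m, rfl⟩
    rw [hF _ h2] at hw
    exact inv_eq_one.1 hw.symm)
  obtain ⟨a, ha⟩ : (⟨z, hz⟩ : Subgroup.center G) ∈ f.range := hf ▸ Subgroup.mem_zpowers _
  obtain ⟨q, rfl⟩ := QuotientGroup.mk_surjective a
  obtain ⟨g, rfl⟩ := QuotientGroup.mk_surjective q
  have h1 := (hM hα).2 g
  rw [hαF, inv_mul_cancel_left] at h1
  have h2 : F g = ⟨z, hz⟩ := ha
  rwa [h2] at h1

/-- If all central automorphisms act trivially modulo `M ≤ [G, G]`, then every homomorphism from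
`G` to its center has image in `M`. -/
theorem apply_mem_of_autcent_le {p : ℕ} [hp : Fact p.Prime] [Finite G] (hG : IsPGroup p G)
    (hna : ∃ a b : G, a * b ≠ b * a) {M : Subgroup G} (hM : autcent G ≤ autUpper M)
    (hMc : M ≤ commutator G) (f : G →* Subgroup.center G) (g : G) : (f g : G) ∈ M := by
  obtain ⟨α, hα, hαf⟩ := exists_mem_autcent_apply f (by
    intro z hz
    obtain ⟨k, hk⟩ := IsPGroup.iff_orderOf.1 (hG.to_subgroup (Subgroup.center G)) z
    rcases k with _ | k
    · exact orderOf_eq_one_iff.1 (by rw [hk, pow_zero])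
    exfalso
    -- This power of `z` has order `p`, so it lies in `M ≤ [G, G]` and `f` kills it, whereas `f`
    -- inverts `z`.
    have h1 : ((z ^ p ^ k : Subgroup.center G) : G) ∈ M := by
      refine mem_of_pow_prime_eq_one hG hna hM (z ^ p ^ k).2 ?_
      rw [← Subgroup.coe_pow, ← pow_mul, ← pow_succ, ← hk, pow_orderOf_eq_one, Subgroup.coe_one]
    have h2 : f (z ^ p ^ k : Subgroup.center G) = 1 :=
      map_eq_one_of_mem_commutator f (hMc h1)
    rw [Subgroup.coe_pow, map_pow, hz, inv_pow, inv_eq_one] at h2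
    have h3 := orderOf_dvd_of_pow_eq_one h2
    rw [hk, Nat.pow_dvd_pow_iff_le_right hp.out.one_lt] at h3
    omega)
  have h1 := (hM hα).2 g
  rwa [hαf, inv_mul_cancel_left] at h1

theorem mem_of_orderOf_dvd_exponent {p : ℕ} [hp : Fact p.Prime] [Finite G] (hG : IsPGroup p G)
    (hna : ∃ a b : G, a * b ≠ b * a) {M : Subgroup G} (hM : autcent G ≤ autUpper M)
    (hMc : M ≤ commutator G) {z : G} (hz : z ∈ Subgroup.center G)
    (hord : orderOf z ∣ Monoid.exponent (Abelianization G)) : z ∈ M := by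
  obtain ⟨k, hk⟩ := IsPGroup.iff_orderOf.1 hG z
  have hA : IsPGroup p (Abelianization G) := hG.to_quotient _
  obtain ⟨f, hf⟩ := exists_monoidHom_range_eq_zpowers (b := (⟨z, hz⟩ : Subgroup.center G)) hA
    ((Subgroup.orderOf_mk z hz).trans hk) (hk ▸ hord)
  obtain ⟨a, ha⟩ : (⟨z, hz⟩ : Subgroup.center G) ∈ f.range := hf ▸ Subgroup.mem_zpowers _
  obtain ⟨g, rfl⟩ := QuotientGroup.mk_surjective a
  have h1 := apply_mem_of_autcent_le hG hna hM hMc (f.comp Abelianization.of) g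
  have h2 : (f.comp Abelianization.of) g = ⟨z, hz⟩ := ha
  rwa [h2] at h1

/-! ### Comparing a subgroup with a larger group by counting -/

theorem exists_isCyclicDecomposition_of_le_center {p : ℕ} [Fact p.Prime] [Finite G]
    (hG : IsPGroup p G) {H : Subgroup G} (hH : H ≤ Subgroup.center G) :
    ∃ (s : ℕ) (e : Fin s → ℕ), IsCyclicDecomposition p H e := by
  let _ : CommGroup H := { (inferInstance : Group H) with
    mul_comm := fun a b => Subtype.ext (Subgroup.mem_center_iff.1 (hH b.2) a) }
  exact exists_isCyclicDecomposition p H (hG.to_subgroup H)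

theorem card_pow_eq_one_le {H K : Subgroup G} [Finite G] (h : H ≤ K) (k : ℕ) :
    Nat.card {a : H // a ^ k = 1} ≤ Nat.card {a : K // a ^ k = 1} := by
  refine Nat.card_le_card_of_injective
    (fun a => ⟨Subgroup.inclusion h a.1, by rw [← map_pow, a.2, map_one]⟩) fun a b hab => ?_
  exact Subtype.ext (Subgroup.inclusion_injective h (congrArg Subtype.val hab))

theorem card_pow_eq_one_eq {H K : Subgroup G} [Finite G] (h : H ≤ K) {k : ℕ}
    (hk : ∀ z ∈ K, z ^ k = 1 → z ∈ H) :
    Nat.card {a : H // a ^ k = 1} = Nat.card {a : K // a ^ k = 1} := by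
  refine le_antisymm (card_pow_eq_one_le h k) (Nat.card_le_card_of_injective
    (fun a => ⟨⟨a.1.1, hk _ a.1.2 (by rw [← Subgroup.coe_pow, a.2, Subgroup.coe_one])⟩,
      Subtype.ext (congrArg (fun x : K => (x : G)) a.2)⟩) fun a b hab => ?_)
  exact Subtype.ext (Subtype.ext (congrArg (fun x => (x.1 : G)) hab))

theorem exists_isLastSmallerFactor {p : ℕ} [hp : Fact p.Prime] [Finite G] {H K : Subgroup G}
    (hHK : H < K) {s : ℕ} {e f : Fin s → ℕ} (he : IsCyclicDecomposition p H e)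
    (hf : IsCyclicDecomposition p K f) : ∃ v, IsLastSmallerFactor p H K v := by
  have hne : ∃ r, e r ≠ f r := by
    by_contra! h
    obtain rfl : e = f := funext h
    obtain ⟨-, -, ⟨φ⟩⟩ := he
    obtain ⟨-, -, ⟨ψ⟩⟩ := hf
    exact hHK.ne (Subgroup.eq_of_le_of_card_ge hHK.le
      (Nat.card_congr (φ.trans ψ.symm).toEquiv).ge)
  classical
  let T : Finset (Fin s) := Finset.univ.filter fun r => e r ≠ f r
  have hT : T.Nonempty := by
    obtain ⟨r, hr⟩ := hne
    exact ⟨r, by simp [T, hr]⟩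
  let r := T.max' hT
  have hr : e r ≠ f r := (Finset.mem_filter.1 (T.max'_mem hT)).2
  have hj : ∀ j, r < j → e j = f j := by
    intro j hj
    by_contra h
    exact (T.le_max' j (by simp [T, h])).not_gt hj
  refine ⟨_, hHK, s, e, f, r, he, hf, ?_, hj, rfl⟩
  refine lt_of_le_of_ne ?_ hr
  -- Were `f r < e r`, the subgroup `H` would have more solutions of `x ^ p ^ (f r + 1) = 1` than
  -- `K`.
  by_contra! hlt
  have h1 := prod_pow_min_lt hp.out.one_lt he.1 hlt fun j hrj => (hj j hrj).symm
  rw [← he.card_pow_eq_one, ← hf.card_pow_eq_one] at h1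
  exact (card_pow_eq_one_le hHK.le _).not_gt h1

theorem IsLastSmallerFactor.exists_notMem {p : ℕ} [hp : Fact p.Prime] [Finite G]
    {H K : Subgroup G} {v : ℕ} (h : IsLastSmallerFactor p H K v) :
    ∃ m, v = p ^ m ∧ ∃ z ∈ K, z ^ p ^ (m + 1) = 1 ∧ z ∉ H := by
  obtain ⟨hHK, s, e, f, r, he, hf, hr, hj, rfl⟩ := h
  refine ⟨e r, rfl, ?_⟩
  by_contra! hz
  have h1 := prod_pow_min_lt hp.out.one_lt hf.1 hr hj
  rw [← he.card_pow_eq_one, ← hf.card_pow_eq_one] at h1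
  exact h1.ne (card_pow_eq_one_eq hHK.le hz)

end CentralAut

theorem theoremt5 (p : ℕ) [Fact p.Prime] (G : Type*) [Group G] [Finite G] (hG : IsPGroup p G)
    (hna : ∃ a b : G, a * b ≠ b * a) (n : ℕ) (hn : 2 ≤ n) :
    (CentralAut.autUpperLower (CentralAut.gamma G n) (Subgroup.center G) = CentralAut.autcent G →
      (CentralAut.gamma G n ≤ Subgroup.center G ∧
        Group.rank (CentralAut.gamma G n) = Group.rank (Subgroup.center G)) ∧
      (CentralAut.var p (CentralAut.gamma G n) (Subgroup.center G) <
          Monoid.exponent (G ⧸ CentralAut.gamma G 2) →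
        CentralAut.gamma G n = Subgroup.center G)) ∧
    (CentralAut.gamma G n = Subgroup.center G →
      CentralAut.var p (CentralAut.gamma G n) (Subgroup.center G) <
          Monoid.exponent (G ⧸ CentralAut.gamma G 2) ∧
        CentralAut.autUpperLower (CentralAut.gamma G n) (Subgroup.center G) =
          CentralAut.autcent G) := by
  have hp : p.Prime := Fact.out
  have hA : IsPGroup p (Abelianization G) := hG.to_quotient _
  rw [CentralAut.exponent_quotient_gamma_two]
  constructor
  · intro h
    have hle := CentralAut.gamma_le_center_of_le_autcent hn h.le
    have hup : CentralAut.autcent G ≤ CentralAut.autUpper (CentralAut.gamma G n) :=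
      h.ge.trans inf_le_left
    obtain ⟨s, e, he⟩ := CentralAut.exists_isCyclicDecomposition_of_le_center hG hle
    obtain ⟨t, f, hf⟩ := CentralAut.exists_isCyclicDecomposition_of_le_center hG
      (le_refl (Subgroup.center G))
    obtain rfl : s = t := by
      have h1 := CentralAut.card_pow_eq_one_eq hle (k := p) fun z hz hzp =>
        CentralAut.mem_of_pow_prime_eq_one hG hna hup hz hzp
      rw [he.card_pow_prime_eq_one, hf.card_pow_prime_eq_one] at h1
      exact Nat.pow_right_injective hp.two_le h1
    refine ⟨⟨hle, ?_⟩, fun hvar => ?_⟩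
    · have : IsMulCommutative (CentralAut.gamma G n) :=
        ⟨⟨fun a b => Subtype.ext (Subgroup.mem_center_iff.1 (hle b.2) a)⟩⟩
      rw [he.rank_eq, hf.rank_eq]
    · by_contra hne
      -- Nonemptiness makes the infimum a genuine value rather than the default `0`.
      have hlast : CentralAut.IsLastSmallerFactor p _ _
          (sInf {v | CentralAut.IsLastSmallerFactor p _ _ v}) := Nat.sInf_mem
        (CentralAut.exists_isLastSmallerFactor (lt_of_le_of_ne hle hne) he hf)
      obtain ⟨m, hm, z, hz, hzp, hzn⟩ := hlast.exists_notMem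
      refine hzn (CentralAut.mem_of_orderOf_dvd_exponent hG hna hup
        (CentralAut.gamma_le_commutator hn) hz ?_)
      rw [CentralAut.var, if_neg hne, hm] at hvar
      -- The exponent is a power `p ^ k`, so exceeding `p ^ m` makes it divisible by `p ^ (m + 1)`.
      obtain ⟨g, hg⟩ := Monoid.exists_orderOf_eq_exponent
        (Monoid.ExponentExists.of_finite (G := Abelianization G))
      obtain ⟨k, hk⟩ := IsPGroup.iff_orderOf.1 hA g
      rw [← hg, hk] at hvar ⊢
      exact (orderOf_dvd_of_pow_eq_one hzp).trans
        (pow_dvd_pow _ ((Nat.pow_lt_pow_iff_right hp.one_lt).1 hvar))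
  · intro h
    refine ⟨?_, CentralAut.autUpperLower_center_eq_autcent h (CentralAut.gamma_le_commutator hn)⟩
    rw [CentralAut.var, if_pos h]
    have : Group.IsNilpotent G := hG.isNilpotent
    have : Nontrivial G := by
      obtain ⟨a, b, hab⟩ := hna
      exact ⟨_, _, hab⟩
    have : Nontrivial (Abelianization G) :=
      QuotientGroup.nontrivial_iff.2 (Group.IsSolvable.commutator_lt_top_of_nontrivial _).ne
    have h1 : Monoid.exponent (Abelianization G) ≠ 1 := fun h1 =>
      not_subsingleton _ (Monoid.exp_eq_one_iff.1 h1)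
    have h0 : Monoid.exponent (Abelianization G) ≠ 0 := Monoid.exponent_ne_zero_of_finite
    omega
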